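/- For integers $b\ge 2$ and $j\ge 1$ let $d_b(j)$ be the sum of the base-$b$ digits of $j$, and for $n\ge1$ let $S_b(n)=\sum_{j=1}^{n-1}d_b(j)$. For $n\ge 1$ and real $x\ge 0$ put $$\overline{A}(n,x)=\sum_{2\le b\le x}\frac{2}{b-1}\,S_b(n)\log b ,$$ where $b$ runs over integers. Let $H_m=\sum_{j=1}^m\frac1j$ and $J_m=\sum_{j=1}^m\frac{\log j}{j}$, let $\gamma$ be Euler's constant, and let $\gamma_1=\lim_{m\to\infty}\left(J_m-\frac12(\log m)^2\right)$ be the first Stieltjes constant. Put $f_A(0)=g_A(0)=0$ and, for $\alpha>0$, $$f_A(\alpha)=\left(\tfrac32-\gamma\right)+\left(H_{\lfloor 1/\alpha\rfloor}-\log\tfrac1\alpha\right)+\tfrac12\alpha^2\left\lfloor\tfrac1\alpha\right\rfloor^2+\tfrac12\alpha^2\left\lfloor\tfrac1\alpha\right\rfloor-2\alpha\left\lfloor\tfrac1\alpha\right\rfloor,$$ $$\begin{aligned}g_A(\alpha)={}&\left(\tfrac32\gamma+\gamma_1-\tfrac74\right)-\tfrac32\left(H_{\lfloor 1/\alpha\rfloor}-\log\tfrac1\alpha\right)-\left(J_{\lfloor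 1/\alpha\rfloor}-\tfrac12\left(\log\tfrac1\alpha\right)^2\right)\\&+\left(\log\tfrac1\alpha\right)\left(-\tfrac32-\tfrac12\alpha^2\left\lfloor\tfrac1\alpha\right\rfloor\left\lfloor\tfrac1\alpha+1\right\rfloor+2\alpha\left\lfloor\tfrac1\alpha\right\rfloor\right)-\tfrac14\alpha^2\left\lfloor\tfrac1\alpha\right\rfloor\left\lfloor\tfrac1\alpha+1\right\rfloor+2\alpha\left\lfloor\tfrac1\alpha\right\rfloor.\end{aligned}$$ Then for all integers $n\ge2$ and all real $\alpha\in\left[\frac1{\sqrt n},1\right]$, $$\overline{A}(n,\alpha n)=f_A(\alpha)\,n^2\log n+g_A(\alpha)\,n^2+O\left(n^{3/2}\log n\right),$$ and for all integers $n\ge2$ and all real $\alpha\in\left[\frac1n,\frac1{\sqrt n}\right]$, $$\overline{A}(n,\alpha n)=O\left(n^{3/2}\log n\right).$$ The implied constants are absolute; in particular they depend neither on $n$ nor on $\alpha$. -/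

import Mathlib

namespace RadixSums

open Filter Topology

/-- The sum `d_b(n)` of the base-`b` digits of `n` (used for `b ≥ 2`). -/
def digitSum (b n : ℕ) : ℕ := (Nat.digits b n).sum

/-- The running digit sum `S_b(n) = ∑_{j=1}^{n-1} d_b(j)`. -/
def runningDigitSum (b n : ℕ) : ℕ := ∑ j ∈ Finset.Ico 1 n, digitSum b j

/-- `A(n, x) = ∑_{2 ≤ b ≤ x} (2 / (b - 1)) S_b(n) log b`. -/
noncomputable def Abar (n : ℕ) (x : ℝ) : ℝ :=
  ∑ b ∈ Finset.Icc 2 ⌊x⌋₊, 2 / ((b : ℝ) - 1) * (runningDigitSum b n : ℝ) * Real.log b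

/-- `H_m = ∑_{j=1}^m 1 / j`. -/
noncomputable def Hsum (m : ℕ) : ℝ := ∑ j ∈ Finset.Icc 1 m, 1 / (j : ℝ)

/-- `J_m = ∑_{j=1}^m (log j) / j`. -/
noncomputable def Jsum (m : ℕ) : ℝ := ∑ j ∈ Finset.Icc 1 m, Real.log j / (j : ℝ)

/-- The first Stieltjes constant
`γ₁ = lim_{n → ∞} (∑_{k=1}^n (log k) / k - (log n)² / 2)`;
the limit exists by `tendsto_stieltjesOne` below. -/
noncomputable def stieltjesOne : ℝ :=
  limUnder atTop (fun n : ℕ => Jsum n - (Real.log n) ^ 2 / 2)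

/-- The coefficient function of `n² log n`. -/
noncomputable def fA (α : ℝ) : ℝ :=
  if α = 0 then 0 else
    (3 / 2 - Real.eulerMascheroniConstant)
      + (Hsum ⌊1 / α⌋₊ - Real.log (1 / α))
      + 1 / 2 * α ^ 2 * (⌊1 / α⌋₊ : ℝ) ^ 2 + 1 / 2 * α ^ 2 * (⌊1 / α⌋₊ : ℝ)
      - 2 * α * (⌊1 / α⌋₊ : ℝ)

/-- The coefficient function of `n²`. -/
noncomputable def gA (α : ℝ) : ℝ :=
  if α = 0 then 0 else
    (3 / 2 * Real.eulerMascheroniConstant + stieltjesOne - 7 / 4)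
      - 3 / 2 * (Hsum ⌊1 / α⌋₊ - Real.log (1 / α))
      - (Jsum ⌊1 / α⌋₊ - 1 / 2 * (Real.log (1 / α)) ^ 2)
      + Real.log (1 / α) *
          (-(3 / 2) - 1 / 2 * α ^ 2 * (⌊1 / α⌋₊ : ℝ) * (⌊1 / α + 1⌋₊ : ℝ)
            + 2 * α * (⌊1 / α⌋₊ : ℝ))
      - 1 / 4 * α ^ 2 * (⌊1 / α⌋₊ : ℝ) * (⌊1 / α + 1⌋₊ : ℝ)
      + 2 * α * (⌊1 / α⌋₊ : ℝ)

lemma half_log_sq_step (n : ℕ) (hn : 3 ≤ n) :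
    Real.log (n + 1 : ℝ) / (n + 1) ≤ Real.log (n + 1 : ℝ) ^ 2 / 2 - Real.log n ^ 2 / 2 ∧
      Real.log (n + 1 : ℝ) ^ 2 / 2 - Real.log n ^ 2 / 2 ≤ Real.log n / n := by
  have hn' : (3 : ℝ) ≤ n := by exact_mod_cast hn
  have he : Real.exp 1 ≤ n := by linarith [Real.exp_one_lt_d9]
  obtain ⟨c, ⟨hc1, hc2⟩, hc⟩ := exists_hasDerivAt_eq_slope
    (fun t : ℝ => Real.log t ^ 2 / 2) (fun t => Real.log t / t)
    (show (n : ℝ) < n + 1 by linarith)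
    (by
      intro t ht
      have : t ≠ 0 := by have := ht.1; linarith
      exact ((((Real.continuousAt_log this).pow 2).div_const 2)).continuousWithinAt)
    (by
      intro t ht
      have h0 : t ≠ 0 := by have := ht.1; linarith
      have := ((Real.hasDerivAt_log h0).pow 2).div_const 2
      refine this.congr_deriv ?_
      simp only [Nat.cast_ofNat, Nat.add_one_sub_one, pow_one]
      ring)
  have hslope : Real.log (n + 1 : ℝ) ^ 2 / 2 - Real.log n ^ 2 / 2 = Real.log c / c := by
    rw [hc]; simp
  rw [hslope]
  exact ⟨Real.log_div_self_antitoneOn (by simp; linarith) (by simp; linarith) hc2.le,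
    Real.log_div_self_antitoneOn (by simpa using he) (by simp; linarith) hc1.le⟩

lemma Jsum_succ (n : ℕ) : Jsum (n + 1) = Jsum n + Real.log (n + 1 : ℝ) / (n + 1) := by
  simp [Jsum, Finset.sum_Icc_succ_top]

/-- The limit defining the first Stieltjes constant exists. -/
theorem tendsto_stieltjesOne :
    Tendsto (fun n : ℕ => Jsum n - (Real.log n) ^ 2 / 2) atTop (𝓝 stieltjesOne) := by
  apply tendsto_nhds_limUnder
  set a : ℕ → ℝ := fun n => Jsum n - (Real.log n) ^ 2 / 2 with ha
  have hanti : Antitone (fun n => a (n + 3)) := by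
    apply antitone_nat_of_succ_le
    intro n
    have h := (half_log_sq_step (n + 3) (by omega)).1
    have e : a (n + 1 + 3) = Jsum (n + 3) + Real.log (((n + 3 : ℕ) : ℝ) + 1) / (((n + 3 : ℕ) : ℝ) + 1)
        - Real.log (((n + 3 : ℕ) : ℝ) + 1) ^ 2 / 2 := by
      rw [ha, show n + 1 + 3 = (n + 3) + 1 by ring]
      simp only [Jsum_succ]; push_cast; ring
    rw [e]
    simp only [ha]
    linarith
  have hmono : Monotone (fun n => a (n + 3) - Real.log ((n + 3 : ℕ) : ℝ) / ((n + 3 : ℕ) : ℝ)) := by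
    apply monotone_nat_of_le_succ
    intro n
    have h := (half_log_sq_step (n + 3) (by omega)).2
    have e : a (n + 1 + 3) - Real.log ((n + 1 + 3 : ℕ) : ℝ) / ((n + 1 + 3 : ℕ) : ℝ)
        = Jsum (n + 3) - Real.log (((n + 3 : ℕ) : ℝ) + 1) ^ 2 / 2 := by
      rw [ha, show n + 1 + 3 = (n + 3) + 1 by ring]
      simp only [Jsum_succ]; push_cast; ring
    rw [e]
    simp only [ha]
    linarith
  have hbdd : BddBelow (Set.range (fun n => a (n + 3))) := by
    refine ⟨a (0 + 3) - Real.log ((0 + 3 : ℕ) : ℝ) / ((0 + 3 : ℕ) : ℝ), ?_⟩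
    rintro _ ⟨n, rfl⟩
    have h1 := hmono (Nat.zero_le n)
    have h2 : 0 ≤ Real.log ((n + 3 : ℕ) : ℝ) / ((n + 3 : ℕ) : ℝ) := by positivity
    simp only at h1 ⊢
    linarith
  exact ⟨_, (tendsto_add_atTop_iff_nat 3).1 (tendsto_atTop_ciInf hanti hbdd)⟩

end RadixSums

/-! If `b ^ 2 ≥ n`, every `j < n` has at most two base-`b` digits, so `S_b(n)` has a closed form. It
gives `2 S_b(n) / (b - 1) = n φ(b/n) + n (n - b) (1/(b-1) - 1/b)` (`two_div_mul_runningDigitSum`).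
Hence `Abar` is, up to a telescoping remainder, a Riemann sum of `n φ(t/n) log t`.

The functions `fA` and `gA` are the antiderivatives of `φ(u)` and `φ(u) log u` that vanish at `0`;
the constants `γ` and `γ₁` are what makes them vanish there. So `mainTerm n` is an antiderivative of
the summand, and the mean value inequality replaces integration. On `[√n, n]` the density varies by
`O(√n log n)` per unit step (`abs_density_sub_le`), for a total of `O(n^{3/2} log n)`. The remainder
telescopes to at most `n² log n / √n`.

Up to `2√n` no cancellation is needed: each summand of `Abar` is `O(n log n)` (`term_le`), and `0 ≤
φ ≤ 1` bounds `mainTerm n t` by `O(n t log n)`. -/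

namespace RadixSums

open Filter Topology

/-! ### The density and its Lipschitz ingredient -/

/-- The density `u ↦ 1 - u {1/u} (1 - {1/u})` of `fA`. -/
noncomputable def phi (u : ℝ) : ℝ := 1 - u * (Int.fract (1 / u) * (1 - Int.fract (1 / u)))

/-- This form occurs both as the derivative of each piece of `fA` and in the closed form of the
running digit sum. -/
lemma phi_eq {u : ℝ} (hu : 0 < u) :
    phi u = 1 / u - 2 * (⌊1 / u⌋₊ : ℝ) + u * (⌊1 / u⌋₊ : ℝ) * ((⌊1 / u⌋₊ : ℝ) + 1) := by
  have h : Int.fract (1 / u) = 1 / u - (⌊1 / u⌋₊ : ℝ) := by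
    rw [Int.fract, natCast_floor_eq_intCast_floor (by positivity)]
  rw [phi, h]
  field_simp
  ring

lemma fract_mul_one_sub_nonneg (y : ℝ) : 0 ≤ Int.fract y * (1 - Int.fract y) :=
  mul_nonneg (Int.fract_nonneg y) (by linarith [Int.fract_lt_one y])

lemma fract_mul_one_sub_le (y : ℝ) : Int.fract y * (1 - Int.fract y) ≤ 1 := by
  nlinarith [Int.fract_nonneg y, Int.fract_lt_one y]

lemma phi_le_one {u : ℝ} (hu : 0 ≤ u) : phi u ≤ 1 := by
  have := mul_nonneg hu (fract_mul_one_sub_nonneg (1 / u))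
  unfold phi; linarith

lemma phi_nonneg {u : ℝ} (hu1 : u ≤ 1) : 0 ≤ phi u := by
  have := mul_le_one₀ hu1 (fract_mul_one_sub_nonneg (1 / u)) (fract_mul_one_sub_le (1 / u))
  unfold phi; linarith

/-- The function `y ↦ {y} (1 - {y})` is `1`-Lipschitz. -/
lemma abs_fract_mul_one_sub_sub_le (y z : ℝ) :
    |Int.fract y * (1 - Int.fract y) - Int.fract z * (1 - Int.fract z)| ≤ |y - z| := by
  wlog h : y ≤ z generalizing y z
  · rw [abs_sub_comm, abs_sub_comm y z]
    exact this z y (le_of_not_ge h)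
  have hy := Int.fract_nonneg y
  have hy' := Int.fract_lt_one y
  have hz := Int.fract_nonneg z
  have hz' := Int.fract_lt_one z
  have ey := Int.floor_add_fract y
  have ez := Int.floor_add_fract z
  rw [abs_sub_comm y z, abs_of_nonneg (sub_nonneg.2 h)]
  rcases (Int.floor_le_floor h).eq_or_lt with he | hlt
  · rw [he] at ey
    have hle : Int.fract y ≤ Int.fract z := by linarith
    rw [abs_le]
    constructor <;> nlinarith
  · have hlt' : (⌊y⌋ : ℝ) + 1 ≤ ⌊z⌋ := by exact_mod_cast hlt
    rw [abs_le]
    constructor <;> nlinarith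

/-! ### Derivatives of `fA` and `gA`, glued across the breakpoints `1/q` -/

/-- A function given on `(1/(q+1), 1/q]` by `F q` is differentiable wherever the adjacent
pieces match to first order. -/
lemma hasDerivAt_of_floor_inv {f : ℝ → ℝ} {F : ℕ → ℝ → ℝ} {a D : ℝ} (ha : 0 < a)
    (hf : ∀ x, 0 < x → f x = F ⌊1 / x⌋₊ x)
    (hD : HasDerivAt (F ⌊1 / a⌋₊) D a)
    (hglue : ∀ q : ℕ, (q + 1 : ℝ) * a = 1 → F q a = F (q + 1) a ∧ HasDerivAt (F q) D a) :
    HasDerivAt f D a := by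
  set q := ⌊1 / a⌋₊ with hq
  have h1 : (q : ℝ) * a ≤ 1 := by
    have := Nat.floor_le (show (0 : ℝ) ≤ 1 / a by positivity)
    rwa [← hq, le_div_iff₀ ha] at this
  have h2 : 1 < ((q : ℝ) + 1) * a := by
    have := Nat.lt_floor_add_one (1 / a)
    rwa [← hq, div_lt_iff₀ ha] at this
  have hfa : f a = F q a := hf a ha
  have ev1 : ∀ᶠ x in 𝓝 a, 1 < ((q : ℝ) + 1) * x :=
    (continuousAt_const.mul continuousAt_id).eventually (lt_mem_nhds h2)
  have ev0 : ∀ᶠ x in 𝓝 a, 0 < x := lt_mem_nhds ha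
  have floor_eq : ∀ (m : ℕ) (x : ℝ), 0 < x → (m : ℝ) * x ≤ 1 → 1 < ((m : ℝ) + 1) * x →
      ⌊1 / x⌋₊ = m := by
    intro m x hx hm1 hm2
    rw [Nat.floor_eq_iff (by positivity), le_div_iff₀ hx, div_lt_iff₀ hx]
    exact ⟨hm1, hm2⟩
  have left : HasDerivWithinAt f D (Set.Iic a) a := by
    refine hD.hasDerivWithinAt.congr_of_eventuallyEq ?_ hfa
    filter_upwards [nhdsWithin_le_nhds ev1, nhdsWithin_le_nhds ev0, self_mem_nhdsWithin]
      with x hx1 hx0 hxa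
    rw [hf x hx0, floor_eq q x hx0 _ hx1]
    exact (mul_le_mul_of_nonneg_left hxa (Nat.cast_nonneg q)).trans h1
  have right : HasDerivWithinAt f D (Set.Ici a) a := by
    -- To the right of `a` the piece is still `F q` unless `a = 1/q`, where the piece of index `q -
    -- 1` takes over.
    rcases h1.lt_or_eq with hlt | heq
    · have ev2 : ∀ᶠ x in 𝓝 a, (q : ℝ) * x < 1 :=
        (continuousAt_const.mul continuousAt_id).eventually (gt_mem_nhds hlt)
      refine hD.hasDerivWithinAt.congr_of_eventuallyEq ?_ hfa
      filter_upwards [nhdsWithin_le_nhds ev1, nhdsWithin_le_nhds ev0, nhdsWithin_le_nhds ev2]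
        with x hx1 hx0 hx2
      rw [hf x hx0, floor_eq q x hx0 hx2.le hx1]
    · clear_value q
      rcases q with _ | p
      · simp at heq
      · push_cast at heq
        obtain ⟨hv, hd⟩ := hglue p heq
        have hlt : (p : ℝ) * a < 1 := by linarith
        have ev2 : ∀ᶠ x in 𝓝 a, (p : ℝ) * x < 1 :=
          (continuousAt_const.mul continuousAt_id).eventually (gt_mem_nhds hlt)
        refine hd.hasDerivWithinAt.congr_of_eventuallyEq ?_ (hfa.trans hv.symm)
        filter_upwards [nhdsWithin_le_nhds ev0, nhdsWithin_le_nhds ev2, self_mem_nhdsWithin]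
          with x hx0 hx2 hxa
        rcases (show a ≤ x from hxa).eq_or_lt with rfl | hax
        · exact hfa.trans hv.symm
        · rw [hf x hx0, floor_eq p x hx0 hx2.le]
          have : ((p : ℝ) + 1) * a < (p + 1) * x := by gcongr
          linarith
  have := left.union right
  rwa [Set.Iic_union_Ici, hasDerivWithinAt_univ] at this

/-- The formula of `fA` with `⌊1/α⌋` replaced by `q`. -/
noncomputable def fPiece (q : ℕ) (α : ℝ) : ℝ :=
  (3 / 2 - Real.eulerMascheroniConstant) + (Hsum q + Real.log α)
    + 1 / 2 * α ^ 2 * ((q : ℝ) * (q + 1)) - 2 * α * q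

/-- The formula of `gA` with `⌊1/α⌋` replaced by `q`. -/
noncomputable def gPiece (q : ℕ) (α : ℝ) : ℝ :=
  (3 / 2 * Real.eulerMascheroniConstant + stieltjesOne - 7 / 4)
    - 3 / 2 * (Hsum q + Real.log α) - (Jsum q - 1 / 2 * Real.log α ^ 2)
    - Real.log α * (-(3 / 2) - 1 / 2 * α ^ 2 * ((q : ℝ) * (q + 1)) + 2 * α * q)
    - 1 / 4 * α ^ 2 * ((q : ℝ) * (q + 1)) + 2 * α * q

lemma fA_eq_fPiece {α : ℝ} (hα : 0 < α) : fA α = fPiece ⌊1 / α⌋₊ α := by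
  rw [fA, if_neg hα.ne', fPiece, one_div, Real.log_inv]
  ring

lemma gA_eq_gPiece {α : ℝ} (hα : 0 < α) : gA α = gPiece ⌊1 / α⌋₊ α := by
  rw [gA, if_neg hα.ne', gPiece, Nat.floor_add_one (by positivity), one_div, Real.log_inv]
  push_cast
  ring

lemma Hsum_succ (n : ℕ) : Hsum (n + 1) = Hsum n + 1 / (n + 1) := by
  simp [Hsum, Finset.sum_Icc_succ_top]

lemma hasDerivAt_fPiece (q : ℕ) {α : ℝ} (hα : 0 < α) :
    HasDerivAt (fPiece q) (1 / α - 2 * q + α * q * (q + 1)) α := by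
  have hl := Real.hasDerivAt_log hα.ne'
  have hi := hasDerivAt_id α
  have h := ((((hl.const_add (Hsum q)).const_add (3 / 2 - Real.eulerMascheroniConstant)).add
    (((hi.pow 2).const_mul (1 / 2)).mul_const ((q : ℝ) * (q + 1)))).sub
    ((hi.const_mul 2).mul_const (q : ℝ)))
  refine h.congr_deriv ?_
  simp
  ring

lemma hasDerivAt_gPiece (q : ℕ) {α : ℝ} (hα : 0 < α) :
    HasDerivAt (gPiece q) ((1 / α - 2 * q + α * q * (q + 1)) * Real.log α) α := by
  have hl := Real.hasDerivAt_log hα.ne'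
  have hi := hasDerivAt_id α
  have hp := (((hi.pow 2).const_mul (1 / 2)).mul_const ((q : ℝ) * (q + 1)))
  have hp' := (((hi.pow 2).const_mul (1 / 4)).mul_const ((q : ℝ) * (q + 1)))
  have h2 := ((hi.const_mul 2).mul_const (q : ℝ))
  have h := (((((((hl.const_add (Hsum q)).const_mul (3 / 2)).const_sub
    (3 / 2 * Real.eulerMascheroniConstant + stieltjesOne - 7 / 4)).sub
    (((hl.pow 2).const_mul (1 / 2)).const_sub (Jsum q))).sub
    (hl.mul ((hp.const_sub (-(3 / 2))).add h2))).sub hp').add h2)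
  refine h.congr_deriv ?_
  simp
  field_simp
  ring

/-- At `α = 1/(q+1)`, passing from `q` to `q + 1` changes the value by `α + α - 2α = 0` and the
slope by `2(q+1)α - 2 = 0`. -/
lemma hasDerivAt_fA {α : ℝ} (hα : 0 < α) : HasDerivAt fA (phi α) α := by
  refine hasDerivAt_of_floor_inv hα (fun x hx => fA_eq_fPiece hx) ?_ ?_
  · rw [phi_eq hα]
    exact hasDerivAt_fPiece _ hα
  · intro q hq
    have ha : α = 1 / (q + 1) := by
      rw [eq_div_iff (by positivity)]; linarith
    have hfl : ⌊1 / α⌋₊ = q + 1 := by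
      rw [ha, one_div_one_div]; exact_mod_cast Nat.floor_natCast (q + 1)
    constructor
    · rw [fPiece, fPiece, Hsum_succ, ha]
      push_cast
      field_simp
      ring
    · refine (hasDerivAt_fPiece q hα).congr_deriv ?_
      rw [phi_eq hα, hfl]
      push_cast
      linear_combination -2 * hq

lemma hasDerivAt_gA {α : ℝ} (hα : 0 < α) : HasDerivAt gA (phi α * Real.log α) α := by
  refine hasDerivAt_of_floor_inv hα (fun x hx => gA_eq_gPiece hx) ?_ ?_
  · rw [phi_eq hα]
    exact hasDerivAt_gPiece _ hα
  · intro q hq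
    have ha : α = 1 / (q + 1) := by
      rw [eq_div_iff (by positivity)]; linarith
    have hfl : ⌊1 / α⌋₊ = q + 1 := by
      rw [ha, one_div_one_div]; exact_mod_cast Nat.floor_natCast (q + 1)
    constructor
    · rw [gPiece, gPiece, Hsum_succ, Jsum_succ, ha, one_div ((q : ℝ) + 1), Real.log_inv]
      push_cast
      field_simp
      ring
    · refine (hasDerivAt_gPiece q hα).congr_deriv ?_
      rw [phi_eq hα, hfl]
      push_cast
      linear_combination (-2 * Real.log α) * hq

/-! ### Continuity at `0` -/

lemma tendsto_log_div_atTop : Tendsto (fun y : ℝ => Real.log y / y) atTop (𝓝 0) := by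
  simpa using Real.tendsto_pow_log_div_mul_add_atTop 1 0 1 one_ne_zero

lemma tendsto_Hsum_sub_log :
    Tendsto (fun n : ℕ => Hsum n - Real.log n) atTop (𝓝 Real.eulerMascheroniConstant) := by
  refine Real.tendsto_harmonic_sub_log.congr fun n => ?_
  rw [harmonic_eq_sum_Icc, Hsum]
  simp

lemma tendsto_floor_ratio : Tendsto (fun y : ℝ => (⌊y⌋₊ : ℝ) / y) atTop (𝓝 1) :=
  tendsto_nat_floor_div_atTop

lemma tendsto_log_floor_ratio :
    Tendsto (fun y : ℝ => Real.log ((⌊y⌋₊ : ℝ) / y)) atTop (𝓝 0) := by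
  simpa using tendsto_floor_ratio.log one_ne_zero

lemma tendsto_log_mul_one_sub_floor_ratio :
    Tendsto (fun y : ℝ => Real.log y * (1 - (⌊y⌋₊ : ℝ) / y)) atTop (𝓝 0) := by
  refine squeeze_zero' ?_ ?_ tendsto_log_div_atTop
  · filter_upwards [eventually_ge_atTop 1] with y hy
    have := Nat.floor_le (zero_le_one.trans hy)
    have h : (⌊y⌋₊ : ℝ) / y ≤ 1 := (div_le_one (by linarith)).2 this
    exact mul_nonneg (Real.log_nonneg hy) (by linarith)
  · filter_upwards [eventually_ge_atTop 1] with y hy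
    have := Nat.lt_floor_add_one y
    have hy0 : 0 < y := by linarith
    rw [div_eq_mul_one_div (Real.log y)]
    refine mul_le_mul_of_nonneg_left ?_ (Real.log_nonneg hy)
    rw [one_sub_div hy0.ne']
    gcongr
    linarith

/-- For `0 < r ≤ 1`, `0 ≤ -log r ≤ (1 - r)/r`, which reduces this to the preceding limit. -/
lemma tendsto_log_mul_log_floor_ratio :
    Tendsto (fun y : ℝ => Real.log y * Real.log ((⌊y⌋₊ : ℝ) / y)) atTop (𝓝 0) := by
  rw [← neg_zero]
  have hbig := tendsto_log_mul_one_sub_floor_ratio.mul (tendsto_floor_ratio.inv₀ one_ne_zero)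
  rw [zero_mul] at hbig
  refine (squeeze_zero' (f := fun y : ℝ => Real.log y * (-Real.log ((⌊y⌋₊ : ℝ) / y)))
    ?_ ?_ hbig).neg.congr (fun y => by ring)
  · filter_upwards [eventually_ge_atTop 1] with y hy
    have := Nat.floor_le (zero_le_one.trans hy)
    have h : (⌊y⌋₊ : ℝ) / y ≤ 1 := (div_le_one (by linarith)).2 this
    exact mul_nonneg (Real.log_nonneg hy)
      (neg_nonneg.2 (Real.log_nonpos (by positivity) h))
  · filter_upwards [eventually_ge_atTop 1] with y hy
    have hq : 0 < ⌊y⌋₊ := Nat.floor_pos.2 hy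
    have hr : 0 < (⌊y⌋₊ : ℝ) / y := by positivity
    rw [mul_assoc]
    refine mul_le_mul_of_nonneg_left ?_ (Real.log_nonneg hy)
    have := Real.one_sub_inv_le_log_of_pos hr
    rw [sub_mul, one_mul, mul_inv_cancel₀ hr.ne']
    linarith

lemma tendsto_fA_inv : Tendsto (fun y : ℝ => fA y⁻¹) atTop (𝓝 0) := by
  have hH := tendsto_Hsum_sub_log.comp (tendsto_nat_floor_atTop (α := ℝ))
  have hr := tendsto_floor_ratio
  have hi := tendsto_inv_atTop_zero (𝕜 := ℝ)
  have h := (((hH.add tendsto_log_floor_ratio).const_add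
    (3 / 2 - Real.eulerMascheroniConstant)).add
    (((hr.pow 2).add (hr.mul hi)).const_mul (1 / 2))).sub (hr.const_mul 2)
  have h0 : 3 / 2 - Real.eulerMascheroniConstant + (Real.eulerMascheroniConstant + 0)
      + 1 / 2 * ((1 : ℝ) ^ 2 + 1 * 0) - 2 * 1 = 0 := by ring
  rw [h0] at h
  refine h.congr' ?_
  filter_upwards [eventually_ge_atTop 1] with y hy
  have hy0 : 0 < y := by linarith
  have hq : 0 < ⌊y⌋₊ := Nat.floor_pos.2 hy
  rw [fA_eq_fPiece (inv_pos.2 hy0), fPiece, one_div y⁻¹, inv_inv, Real.log_inv,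
    Real.log_div (by positivity) hy0.ne']
  simp only [Function.comp]
  field_simp
  ring

lemma tendsto_gA_inv : Tendsto (fun y : ℝ => gA y⁻¹) atTop (𝓝 0) := by
  have hH := tendsto_Hsum_sub_log.comp (tendsto_nat_floor_atTop (α := ℝ))
  have hJ := tendsto_stieltjesOne.comp (tendsto_nat_floor_atTop (α := ℝ))
  have hr := tendsto_floor_ratio
  have hl := tendsto_log_floor_ratio
  have hll := tendsto_log_mul_log_floor_ratio
  have hd := tendsto_log_mul_one_sub_floor_ratio
  have hi := tendsto_inv_atTop_zero (𝕜 := ℝ)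
  -- With `q = ⌊y⌋` and `r = q/y`, the divergent logarithms are regrouped by `J_q - ½ log² y = (J_q
  -- - ½ log² q) + ½ log² r + log y log r`. The factor of `log y` becomes `-3/2 - ½ r² + 2r - r/(2y)
  -- = -(1-r) - ½ (1-r)² - r/(2y)`.
  have h := (((((((hH.add hl).const_mul (3 / 2)).const_sub
    (3 / 2 * Real.eulerMascheroniConstant + stieltjesOne - 7 / 4)).sub
    (hJ.add (((hl.pow 2).const_mul (1 / 2)).add hll))).add
    ((hd.neg.sub ((hd.mul (hr.const_sub 1)).const_mul (1 / 2))).sub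
      ((tendsto_log_div_atTop.mul hr).const_mul (1 / 2)))).sub
    (((hr.pow 2).add (hr.mul hi)).const_mul (1 / 4))).add (hr.const_mul 2))
  have h0 : 3 / 2 * Real.eulerMascheroniConstant + stieltjesOne - 7 / 4
      - 3 / 2 * (Real.eulerMascheroniConstant + 0)
      - (stieltjesOne + (1 / 2 * (0 : ℝ) ^ 2 + 0))
      + (-0 - 1 / 2 * (0 * (1 - 1)) - 1 / 2 * (0 * 1))
      - 1 / 4 * ((1 : ℝ) ^ 2 + 1 * 0) + 2 * 1 = 0 := by ring
  rw [h0] at h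
  refine h.congr' ?_
  filter_upwards [eventually_ge_atTop 1] with y hy
  have hy0 : 0 < y := by linarith
  have hq : 0 < ⌊y⌋₊ := Nat.floor_pos.2 hy
  rw [gA_eq_gPiece (inv_pos.2 hy0), gPiece, one_div y⁻¹, inv_inv, Real.log_inv,
    Real.log_div (by positivity) hy0.ne']
  simp only [Function.comp]
  field_simp
  ring

lemma continuousWithinAt_zero_of_tendsto_inv {f : ℝ → ℝ} (h0 : f 0 = 0)
    (h : Tendsto (fun y : ℝ => f y⁻¹) atTop (𝓝 0)) : ContinuousWithinAt f (Set.Ici 0) 0 := by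
  rw [← continuousWithinAt_Ioi_iff_Ici, ContinuousWithinAt, h0]
  refine (h.comp tendsto_inv_nhdsGT_zero).congr fun x => ?_
  simp

lemma continuousOn_fA : ContinuousOn fA (Set.Ici 0) := by
  intro x hx
  rcases (show 0 ≤ x from hx).eq_or_lt with rfl | h
  · exact continuousWithinAt_zero_of_tendsto_inv (by simp [fA]) tendsto_fA_inv
  · exact (hasDerivAt_fA h).continuousAt.continuousWithinAt

lemma continuousOn_gA : ContinuousOn gA (Set.Ici 0) := by
  intro x hx
  rcases (show 0 ≤ x from hx).eq_or_lt with rfl | h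
  · exact continuousWithinAt_zero_of_tendsto_inv (by simp [gA]) tendsto_gA_inv
  · exact (hasDerivAt_gA h).continuousAt.continuousWithinAt

/-! ### Bounds for `fA` and `gA` on `[0, 1]` -/

/-- A function vanishing at `0` with nonnegative derivative on `(0, 1)` is nonnegative. -/
lemma nonneg_of_hasDerivAt_nonneg {f f' : ℝ → ℝ} (h0 : f 0 = 0)
    (hc : ContinuousOn f (Set.Ici 0)) (hd : ∀ x, 0 < x → HasDerivAt f (f' x) x)
    (hn : ∀ x, 0 < x → x < 1 → 0 ≤ f' x) {a : ℝ} (ha : 0 ≤ a) (ha1 : a ≤ 1) : 0 ≤ f a := by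
  have hm : MonotoneOn f (Set.Icc 0 1) := by
    refine monotoneOn_of_deriv_nonneg (convex_Icc 0 1) (hc.mono Set.Icc_subset_Ici_self) ?_ ?_
    · rw [interior_Icc]
      exact fun x hx => (hd x hx.1).differentiableAt.differentiableWithinAt
    · rw [interior_Icc]
      intro x hx
      rw [(hd x hx.1).deriv]
      exact hn x hx.1 hx.2
  rw [← h0]
  exact hm ⟨le_rfl, zero_le_one⟩ ⟨ha, ha1⟩ ha

lemma fA_nonneg {a : ℝ} (ha : 0 ≤ a) (ha1 : a ≤ 1) : 0 ≤ fA a :=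
  nonneg_of_hasDerivAt_nonneg (by simp [fA]) continuousOn_fA (fun _ => hasDerivAt_fA)
    (fun _ _ hx1 => phi_nonneg hx1.le) ha ha1

lemma fA_le {a : ℝ} (ha : 0 ≤ a) (ha1 : a ≤ 1) : fA a ≤ a := by
  have := nonneg_of_hasDerivAt_nonneg (f := fun x => x - fA x) (f' := fun x => 1 - phi x)
    (by simp [fA]) (continuousOn_id.sub continuousOn_fA)
    (fun x hx => (hasDerivAt_id x).sub (hasDerivAt_fA hx))
    (fun x hx _ => sub_nonneg.2 (phi_le_one hx.le)) ha ha1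
  linarith

lemma gA_nonpos {a : ℝ} (ha : 0 ≤ a) (ha1 : a ≤ 1) : gA a ≤ 0 := by
  have := nonneg_of_hasDerivAt_nonneg (f := fun x => -gA x)
    (f' := fun x => -(phi x * Real.log x))
    (by simp [gA]) continuousOn_gA.neg (fun x hx => (hasDerivAt_gA hx).neg)
    (fun x hx hx1 => neg_nonneg.2 (mul_nonpos_of_nonneg_of_nonpos (phi_nonneg hx1.le)
      (Real.log_nonpos hx.le hx1.le))) ha ha1
  linarith

/-- On `(0, 1)`, `φ log ≥ log` because `φ ≤ 1` and `log ≤ 0`; the left side is the antiderivative of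
`log` vanishing at `0`. -/
lemma le_gA {a : ℝ} (ha : 0 ≤ a) (ha1 : a ≤ 1) : a * Real.log a - a ≤ gA a := by
  have := nonneg_of_hasDerivAt_nonneg (f := fun x => gA x - (x * Real.log x - x))
    (f' := fun x => phi x * Real.log x - (Real.log x + 1 - 1))
    (by simp [gA])
    (continuousOn_gA.sub (Real.continuous_mul_log.sub continuous_id).continuousOn)
    (fun x hx => (hasDerivAt_gA hx).sub ((Real.hasDerivAt_mul_log hx.ne').sub (hasDerivAt_id x)))
    (fun x hx hx1 => by
      nlinarith [phi_le_one hx.le, Real.log_nonpos hx.le hx1.le]) ha ha1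
  linarith

/-! ### Digit sums: two-digit formula and trivial bounds -/

lemma digitSum_zero (b : ℕ) : digitSum b 0 = 0 := by simp [digitSum]

lemma digitSum_eq_mod_add {b : ℕ} (hb : 2 ≤ b) (j : ℕ) :
    digitSum b j = j % b + digitSum b (j / b) := by
  rcases j.eq_zero_or_pos with rfl | hj
  · simp [digitSum]
  · rw [digitSum, Nat.digits_def' hb hj, List.sum_cons, digitSum]

lemma digitSum_of_lt {b j : ℕ} (hb : 2 ≤ b) (hj : j < b) : digitSum b j = j := by
  rw [digitSum_eq_mod_add hb, Nat.div_eq_of_lt hj, digitSum_zero, Nat.mod_eq_of_lt hj, add_zero]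

lemma digitSum_of_lt_sq {b j : ℕ} (hb : 2 ≤ b) (hj : j < b ^ 2) :
    (digitSum b j : ℝ) = j - ((b : ℝ) - 1) * (j / b : ℕ) := by
  rw [digitSum_eq_mod_add hb, digitSum_of_lt hb (Nat.div_lt_of_lt_mul (by rwa [← sq]))]
  have h : ((j % b : ℕ) : ℝ) + b * (j / b : ℕ) = j := by exact_mod_cast Nat.mod_add_div j b
  push_cast
  linarith

lemma runningDigitSum_succ (b n : ℕ) :
    runningDigitSum b (n + 1) = runningDigitSum b n + digitSum b n := by
  rcases n.eq_zero_or_pos with rfl | hn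
  · simp [runningDigitSum, digitSum_zero]
  · rw [runningDigitSum, Finset.sum_Ico_succ_top hn, runningDigitSum]

lemma two_mul_runningDigitSum {b n : ℕ} (hb : 2 ≤ b) (hn : n ≤ b ^ 2) :
    2 * (runningDigitSum b n : ℝ) = n * (n - 1) - ((b : ℝ) - 1) *
      (2 * (n / b : ℕ) * n - b * (n / b : ℕ) * ((n / b : ℕ) + 1)) := by
  induction n with
  | zero => simp [runningDigitSum]
  | succ n ih =>
    have ih := ih (by omega)
    rw [runningDigitSum_succ, Nat.succ_div]
    push_cast
    rw [mul_add, ih, digitSum_of_lt_sq hb (by omega)]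
    split_ifs with hd
    · obtain ⟨c, hc⟩ := hd
      have hq : n / b + 1 = c := by
        have := Nat.succ_div (a := n) (b := b)
        rw [if_pos ⟨c, hc⟩, hc, Nat.mul_div_cancel_left c (by omega)] at this
        exact this.symm
      have hc' : (n : ℝ) + 1 = b * ((n / b : ℕ) + 1) := by
        rw [← Nat.cast_add_one (n / b), hq]
        exact_mod_cast hc
      -- When the quotient `q` rises to `q + 1`, the formula changes by a multiple of `(n + 1) - b
      -- (q + 1) = 0`.
      linear_combination (2 * ((b : ℝ) - 1)) * hc'
    · ring

/-- The last term is `n(n-1)/(b-1) - n²/b`, written so that its factor in `b` telescopes. -/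
lemma two_div_mul_runningDigitSum {b n : ℕ} (hb : 2 ≤ b) (hn0 : 0 < n) (hn : n ≤ b ^ 2) :
    2 / ((b : ℝ) - 1) * (runningDigitSum b n : ℝ)
      = n * phi (b / n) + n * (n - b) * (1 / ((b : ℝ) - 1) - 1 / b) := by
  have hb' : (2 : ℝ) ≤ b := by exact_mod_cast hb
  have hb1 : (b : ℝ) - 1 ≠ 0 := by linarith
  have hb0 : (b : ℝ) ≠ 0 := by linarith
  have hn' : (0 : ℝ) < n := by exact_mod_cast hn0
  rw [phi_eq (by positivity), one_div_div, Nat.floor_div_eq_div, div_mul_eq_mul_div,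
    two_mul_runningDigitSum hb hn]
  field_simp
  ring

lemma digitSum_le {b j n : ℕ} (hb : 2 ≤ b) (hj : j ≤ n) :
    digitSum b j ≤ (Nat.log b n + 1) * (b - 1) := by
  rcases j.eq_zero_or_pos with rfl | h0
  · simp [digitSum_zero]
  · calc digitSum b j ≤ (Nat.digits b j).length • (b - 1) :=
          List.sum_le_card_nsmul _ _ fun x hx => by
            have := Nat.digits_lt_base hb hx
            omega
      _ ≤ (Nat.log b n + 1) * (b - 1) := by
          rw [smul_eq_mul, Nat.length_digits b j hb h0.ne']
          gcongr

lemma runningDigitSum_le {b n : ℕ} (hb : 2 ≤ b) :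
    runningDigitSum b n ≤ n * ((Nat.log b n + 1) * (b - 1)) := by
  calc runningDigitSum b n ≤ (Finset.Ico 1 n).card • ((Nat.log b n + 1) * (b - 1)) :=
        Finset.sum_le_card_nsmul _ _ _ fun j hj =>
          digitSum_le hb (Finset.mem_Ico.1 hj).2.le
    _ ≤ _ := by
        rw [smul_eq_mul, Nat.card_Ico]
        gcongr
        omega

/-- There are at most `log_b n + 1` digits, each at most `b - 1`. The factor `log b` turns the digit
count into at most `log n + log b ≤ 2 log n`. -/
lemma term_le {b n : ℕ} (hb : 2 ≤ b) (hbn : b ≤ n) :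
    2 / ((b : ℝ) - 1) * (runningDigitSum b n : ℝ) * Real.log b ≤ 4 * n * Real.log n := by
  have hb' : (2 : ℝ) ≤ b := by exact_mod_cast hb
  have hbn' : (b : ℝ) ≤ n := by exact_mod_cast hbn
  have hb1 : (0 : ℝ) < (b : ℝ) - 1 := by linarith
  have hlb : 0 ≤ Real.log b := Real.log_nonneg (by linarith)
  have hS : (runningDigitSum b n : ℝ) ≤ n * ((Nat.log b n + 1) * (b - 1)) := by
    have : ((b - 1 : ℕ) : ℝ) = (b : ℝ) - 1 := by push_cast [show 1 ≤ b by omega]; ring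
    rw [← this]
    exact_mod_cast runningDigitSum_le hb
  have hlog : (Nat.log b n : ℝ) * Real.log b ≤ Real.log n := by
    rw [← Real.log_pow]
    refine Real.log_le_log (by positivity) ?_
    exact_mod_cast Nat.pow_log_le_self b (by omega)
  have hlbn : Real.log b ≤ Real.log n := Real.log_le_log (by linarith) hbn'
  calc 2 / ((b : ℝ) - 1) * (runningDigitSum b n : ℝ) * Real.log b
      ≤ 2 / ((b : ℝ) - 1) * (n * ((Nat.log b n + 1) * (b - 1))) * Real.log b := by gcongr
    _ = 2 * n * (Nat.log b n * Real.log b + Real.log b) := by field_simp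
    _ ≤ 2 * n * (Real.log n + Real.log n) := by gcongr
    _ = 4 * n * Real.log n := by ring

lemma term_nonneg {b : ℕ} (hb : 2 ≤ b) (n : ℕ) :
    0 ≤ 2 / ((b : ℝ) - 1) * (runningDigitSum b n : ℝ) * Real.log b := by
  have hb' : (2 : ℝ) ≤ b := by exact_mod_cast hb
  have hb1 : (0 : ℝ) < (b : ℝ) - 1 := by linarith
  have hlb : 0 ≤ Real.log b := Real.log_nonneg (by linarith)
  positivity

lemma Abar_nonneg (n : ℕ) (x : ℝ) : 0 ≤ Abar n x :=
  Finset.sum_nonneg fun _ hb => term_nonneg (Finset.mem_Icc.1 hb).1 n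

lemma Abar_le {n : ℕ} {x : ℝ} (hx0 : 0 ≤ x) (hx : x ≤ n) :
    Abar n x ≤ 4 * n * x * Real.log n := by
  have hX : ⌊x⌋₊ ≤ n := Nat.floor_le_of_le hx
  have hl : 0 ≤ Real.log n := Real.log_natCast_nonneg n
  calc Abar n x ≤ (Finset.Icc 2 ⌊x⌋₊).card • (4 * n * Real.log n) :=
        Finset.sum_le_card_nsmul _ _ _ fun b hb =>
          term_le (Finset.mem_Icc.1 hb).1 ((Finset.mem_Icc.1 hb).2.trans hX)
    _ ≤ x * (4 * n * Real.log n) := by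
        rw [nsmul_eq_mul]
        gcongr
        refine le_trans ?_ (Nat.floor_le hx0)
        rw [Nat.card_Icc]
        exact_mod_cast (by omega)
    _ = 4 * n * x * Real.log n := by ring

/-! ### The main term and its density -/

/-- The main term of `Abar n t`. -/
noncomputable def mainTerm (n : ℕ) (t : ℝ) : ℝ :=
  fA (t / n) * (n : ℝ) ^ 2 * Real.log n + gA (t / n) * (n : ℝ) ^ 2

lemma half_le_log {n : ℕ} (hn : 2 ≤ n) : 1 / 2 ≤ Real.log n := by
  have h : Real.log 2 ≤ Real.log n := Real.log_le_log (by norm_num) (by exact_mod_cast hn)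
  linarith [Real.log_two_gt_d9]

/-- The `log n` beside `fA` and the `log (t/n)` from `gA` add up to `log t`. -/
lemma hasDerivAt_mainTerm {n : ℕ} (hn : 0 < n) {t : ℝ} (ht : 0 < t) :
    HasDerivAt (mainTerm n) (n * phi (t / n) * Real.log t) t := by
  have hn' : (0 : ℝ) < n := by exact_mod_cast hn
  have hu : 0 < t / n := by positivity
  have hi := (hasDerivAt_id t).div_const (n : ℝ)
  have hf := (HasDerivAt.comp t (hasDerivAt_fA hu) hi)
  have hg := (HasDerivAt.comp t (hasDerivAt_gA hu) hi)
  refine (((hf.mul_const ((n : ℝ) ^ 2)).mul_const (Real.log n)).add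
    (hg.mul_const ((n : ℝ) ^ 2))).congr_deriv ?_
  rw [id, Real.log_div ht.ne' hn'.ne']
  field_simp
  ring

lemma abs_mainTerm_le {n : ℕ} (hn : 2 ≤ n) {t : ℝ} (ht : 1 ≤ t) (htn : t ≤ n) :
    |mainTerm n t| ≤ 4 * n * t * Real.log n := by
  have hn' : (0 : ℝ) < n := by positivity
  have hl := half_le_log hn
  have ha : 0 ≤ t / n := by positivity
  have ha1 : t / n ≤ 1 := (div_le_one hn').2 htn
  have f0 := fA_nonneg ha ha1
  have f1 := fA_le ha ha1
  have g0 := gA_nonpos ha ha1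
  have g1 := le_gA ha ha1
  have hlt : 0 ≤ Real.log t := Real.log_nonneg ht
  rw [Real.log_div (by positivity) hn'.ne'] at g1
  have hf : fA (t / n) * (n : ℝ) ^ 2 * Real.log n ≤ n * t * Real.log n := by
    calc _ ≤ t / n * (n : ℝ) ^ 2 * Real.log n := by gcongr
      _ = _ := by field_simp
  have hf0 : 0 ≤ fA (t / n) * (n : ℝ) ^ 2 * Real.log n := by positivity
  have hg : -(n * t * (Real.log n + 1)) ≤ gA (t / n) * (n : ℝ) ^ 2 := by
    calc -(n * t * (Real.log n + 1)) = (t / n * (0 - Real.log n) - t / n) * (n : ℝ) ^ 2 := by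
          field_simp; ring
      _ ≤ (t / n * (Real.log t - Real.log n) - t / n) * (n : ℝ) ^ 2 := by gcongr
      _ ≤ _ := by gcongr
  have hg0 : gA (t / n) * (n : ℝ) ^ 2 ≤ 0 := mul_nonpos_of_nonpos_of_nonneg g0 (by positivity)
  have hnt : 0 < n * t := by positivity
  rw [abs_le, mainTerm]
  constructor <;> nlinarith

/-- The derivative of `mainTerm n` varies by `O(√n log n)` on unit intervals in `[√n, n]`. -/
lemma abs_density_sub_le {n : ℕ} (hn : 2 ≤ n) {t b : ℝ} (hst : Real.sqrt n ≤ t) (htb : t ≤ b)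
    (hbt : b ≤ t + 1) (hbn : b ≤ n) :
    |n * phi (t / n) * Real.log t - n * phi (b / n) * Real.log b|
      ≤ 4 * Real.sqrt n * Real.log n := by
  have hn' : (0 : ℝ) < n := by positivity
  have hn2 : (2 : ℝ) ≤ n := by exact_mod_cast hn
  have hl := half_le_log hn
  set s := Real.sqrt n with hs
  have hss : s * s = n := Real.mul_self_sqrt hn'.le
  have hs1 : 1 ≤ s := Real.one_le_sqrt.2 (by linarith)
  have ht0 : 0 < t := by linarith
  have hb0 : 0 < b := by linarith
  have hlt : 0 ≤ Real.log b := Real.log_nonneg (by linarith)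
  have hlb : Real.log b ≤ Real.log n := Real.log_le_log hb0 hbn
  have hdiv : ∀ u, s ≤ u → n / u ≤ s := by
    intro u hu
    rw [div_le_iff₀ (by linarith), ← hss]
    gcongr
  have hlog : |Real.log t - Real.log b| ≤ 1 / t := by
    have h1 : Real.log t ≤ Real.log b := Real.log_le_log ht0 htb
    have h2 := Real.log_le_sub_one_of_pos (div_pos hb0 ht0)
    rw [Real.log_div hb0.ne' ht0.ne'] at h2
    have h3 : b / t - 1 ≤ 1 / t := by
      rw [div_sub_one ht0.ne']; gcongr; linarith
    rw [abs_le]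
    constructor <;> linarith
  have hphi : |n * phi (t / n)| ≤ n := by
    have p0 := phi_nonneg (u := t / n) ((div_le_one hn').2 (by linarith))
    have p1 := phi_le_one (u := t / n) (by positivity)
    rw [abs_of_nonneg (by positivity)]
    exact mul_le_of_le_one_right hn'.le p1
  -- In this form `u` multiplies a 1-Lipschitz function of `n/u`. Between `t` and `b` the argument
  -- moves by at most `√n / t`, so the factor `t` leaves only `√n`.
  have hpsi : ∀ u, 0 < u → n * phi (u / n)
      = n - u * (Int.fract (n / u) * (1 - Int.fract (n / u))) := by
    intro u hu
    rw [phi, one_div_div]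
    field_simp
  have hdiff : |n * phi (t / n) - n * phi (b / n)| ≤ 2 * s := by
    rw [hpsi t ht0, hpsi b hb0]
    have hlip := abs_fract_mul_one_sub_sub_le (n / t) (n / b)
    have hb1 := fract_mul_one_sub_le (n / b)
    have hb2 := fract_mul_one_sub_nonneg (n / b)
    set p := Int.fract (n / t) * (1 - Int.fract (n / t))
    set r := Int.fract (n / b) * (1 - Int.fract (n / b))
    have e : |(n : ℝ) / t - n / b| ≤ s / t := by
      have : (n : ℝ) / t - n / b = (b - t) * (n / b) / t := by field_simp
      rw [this, abs_of_nonneg (div_nonneg (mul_nonneg (by linarith) (by positivity)) ht0.le)]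
      gcongr
      calc (b - t) * (n / b) ≤ 1 * s := by
            gcongr
            · linarith
            · exact hdiv b (by linarith)
        _ = s := one_mul s
    calc |n - t * p - (n - b * r)| = |(b - t) * r - t * (p - r)| := by ring_nf
      _ ≤ |(b - t) * r| + |t * (p - r)| := abs_sub _ _
      _ ≤ 1 + s := by
          gcongr
          · rw [abs_of_nonneg (mul_nonneg (by linarith) hb2)]
            exact mul_le_one₀ (by linarith) hb2 hb1
          · rw [abs_mul, abs_of_pos ht0]
            calc t * |p - r| ≤ t * (s / t) := by gcongr; exact hlip.trans e
              _ = s := by field_simp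
      _ ≤ 2 * s := by linarith
  calc |n * phi (t / n) * Real.log t - n * phi (b / n) * Real.log b|
      = |n * phi (t / n) * (Real.log t - Real.log b)
          + (n * phi (t / n) - n * phi (b / n)) * Real.log b| := by ring_nf
    _ ≤ |n * phi (t / n) * (Real.log t - Real.log b)|
          + |(n * phi (t / n) - n * phi (b / n)) * Real.log b| := abs_add_le _ _
    _ ≤ n * (1 / t) + 2 * s * Real.log n := by
        rw [abs_mul, abs_mul (n * phi (t / n) - _), abs_of_nonneg hlt]
        gcongr
    _ ≤ s + 2 * s * Real.log n := by
        gcongr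
        rw [mul_one_div]
        exact hdiv t hst
    _ ≤ 4 * s * Real.log n := by nlinarith

lemma abs_density_le {n : ℕ} {t : ℝ} (ht : 1 ≤ t) (htn : t ≤ n) :
    |n * phi (t / n) * Real.log t| ≤ n * Real.log n := by
  have hn' : (0 : ℝ) < n := by linarith
  have p0 := phi_nonneg (u := t / n) ((div_le_one hn').2 (by linarith))
  have p1 := phi_le_one (u := t / n) (by positivity)
  have hl : 0 ≤ Real.log t := Real.log_nonneg ht
  rw [abs_of_nonneg (by positivity)]
  calc n * phi (t / n) * Real.log t ≤ n * 1 * Real.log n := by gcongr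
    _ = n * Real.log n := by ring

lemma abs_mainTerm_sub_le {n : ℕ} {x y : ℝ} (hx : 1 ≤ x) (hxy : x ≤ y) (hyn : y ≤ n) :
    |mainTerm n y - mainTerm n x| ≤ n * Real.log n * (y - x) := by
  have hn : 0 < n := by
    have : (0 : ℝ) < n := by linarith
    exact_mod_cast this
  have := (convex_Icc x y).norm_image_sub_le_of_norm_hasDerivWithin_le
    (f := mainTerm n) (C := n * Real.log n)
    (fun t ht => (hasDerivAt_mainTerm hn (by linarith [ht.1])).hasDerivWithinAt)
    (fun t ht => abs_density_le (hx.trans ht.1) (ht.2.trans hyn))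
    (Set.left_mem_Icc.2 hxy) (Set.right_mem_Icc.2 hxy)
  simpa [Real.norm_eq_abs, abs_of_nonneg (sub_nonneg.2 hxy)] using this

/-- Subtracting the linear function `t * D` makes the derivative the variation of the density over
the unit interval; the mean value inequality then applies. -/
lemma abs_mainTerm_step_le {n : ℕ} (hn : 2 ≤ n) {m : ℝ} (hm : Real.sqrt n ≤ m)
    (hmn : m + 1 ≤ n) :
    |mainTerm n (m + 1) - mainTerm n m - n * phi ((m + 1) / n) * Real.log (m + 1)|
      ≤ 4 * Real.sqrt n * Real.log n := by
  have hs1 : 1 ≤ Real.sqrt n := Real.one_le_sqrt.2 (by exact_mod_cast (by omega))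
  set D := n * phi ((m + 1) / n) * Real.log (m + 1)
  have := (convex_Icc m (m + 1)).norm_image_sub_le_of_norm_hasDerivWithin_le
    (f := fun t => mainTerm n t - t * D) (C := 4 * Real.sqrt n * Real.log n)
    (fun t ht => ((hasDerivAt_mainTerm (by omega) (by linarith [ht.1])).sub
      ((hasDerivAt_id t).mul_const D)).hasDerivWithinAt)
    (fun t ht => by
      rw [one_mul]
      exact abs_density_sub_le hn (hm.trans ht.1) ht.2 (by linarith [ht.1]) hmn)
    (Set.left_mem_Icc.2 (by linarith)) (Set.right_mem_Icc.2 (by linarith))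
  rw [Real.norm_eq_abs, Real.norm_eq_abs, add_sub_cancel_left, abs_one, mul_one] at this
  convert this using 2
  ring

/-! ### Comparing `Abar` with the main term -/

lemma Abar_natCast_succ {n m : ℕ} (hm : 1 ≤ m) :
    Abar n ((m + 1 : ℕ) : ℝ) = Abar n (m : ℝ) + 2 / (((m + 1 : ℕ) : ℝ) - 1)
      * (runningDigitSum (m + 1) n : ℝ) * Real.log ((m + 1 : ℕ) : ℝ) := by
  rw [Abar, Abar, Nat.floor_natCast, Nat.floor_natCast, Finset.sum_Icc_succ_top (by omega)]

lemma abs_Abar_step_le {n m : ℕ} (hn : 2 ≤ n) (hm : Real.sqrt n ≤ m) (hmn : m + 1 ≤ n) :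
    |2 / (((m + 1 : ℕ) : ℝ) - 1) * (runningDigitSum (m + 1) n : ℝ) * Real.log ((m + 1 : ℕ) : ℝ)
        - (mainTerm n ((m + 1 : ℕ) : ℝ) - mainTerm n m)|
      ≤ 4 * Real.sqrt n * Real.log n
        + (n : ℝ) ^ 2 * Real.log n * (1 / (m : ℝ) - 1 / ((m + 1 : ℕ) : ℝ)) := by
  have hs1 : 1 ≤ Real.sqrt n := Real.one_le_sqrt.2 (by exact_mod_cast (by omega))
  have hm1 : (1 : ℝ) ≤ m := hs1.trans hm
  have hm1' : 1 ≤ m := by exact_mod_cast hm1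
  have hsq : n ≤ (m + 1) ^ 2 := by
    have h : (n : ℝ) ≤ (m : ℝ) ^ 2 := (Real.sqrt_le_left (by positivity)).1 hm
    have h' : n ≤ m ^ 2 := by exact_mod_cast h
    nlinarith
  have hmn' : (m : ℝ) + 1 ≤ n := by exact_mod_cast hmn
  have hstep := abs_mainTerm_step_le hn hm hmn'
  rw [two_div_mul_runningDigitSum (by omega) (by omega) hsq]
  push_cast
  rw [add_sub_cancel_right]
  have hd : 0 ≤ 1 / (m : ℝ) - 1 / ((m : ℝ) + 1) :=
    sub_nonneg.2 (by gcongr; linarith)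
  have hl0 : 0 ≤ Real.log ((m : ℝ) + 1) := Real.log_nonneg (by linarith)
  have hl1 : Real.log ((m : ℝ) + 1) ≤ Real.log n := Real.log_le_log (by linarith) hmn'
  set d := 1 / (m : ℝ) - 1 / ((m : ℝ) + 1)
  have hE0 : 0 ≤ n * (n - ((m : ℝ) + 1)) * d * Real.log ((m : ℝ) + 1) :=
    mul_nonneg (mul_nonneg (mul_nonneg (by positivity) (by linarith)) hd) hl0
  have hE1 : n * (n - ((m : ℝ) + 1)) * d * Real.log ((m : ℝ) + 1)
      ≤ (n : ℝ) ^ 2 * Real.log n * d := by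
    calc _ ≤ n * n * d * Real.log n := by
          gcongr
          linarith
      _ = _ := by ring
  rw [abs_le] at hstep ⊢
  constructor <;> linarith [hstep.1, hstep.2]

lemma abs_Abar_sub_mainTerm_le_of_le {n M X : ℕ} (hn : 2 ≤ n) (hM : Real.sqrt n ≤ M)
    (hMX : M ≤ X) (hX : X ≤ n) :
    |Abar n (X : ℝ) - mainTerm n X| ≤ |Abar n (M : ℝ) - mainTerm n M|
      + 4 * Real.sqrt n * Real.log n * ((X : ℝ) - M)
      + (n : ℝ) ^ 2 * Real.log n * (1 / (M : ℝ) - 1 / (X : ℝ)) := by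
  induction X, hMX using Nat.le_induction with
  | base => simp
  | succ m hm ih =>
    have ih := ih (by omega)
    have hMm : (M : ℝ) ≤ m := by exact_mod_cast hm
    have hs1 : 1 ≤ Real.sqrt n := Real.one_le_sqrt.2 (by exact_mod_cast (by omega))
    have hm1 : 1 ≤ m := by exact_mod_cast (hs1.trans hM).trans hMm
    have hstep := abs_Abar_step_le hn (hM.trans hMm) hX
    rw [Abar_natCast_succ hm1]
    set T := 2 / (((m + 1 : ℕ) : ℝ) - 1) * (runningDigitSum (m + 1) n : ℝ)
      * Real.log ((m + 1 : ℕ) : ℝ)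
    have hc : ((m + 1 : ℕ) : ℝ) = m + 1 := by push_cast; ring
    calc |Abar n m + T - mainTerm n ((m + 1 : ℕ) : ℝ)|
        = |(Abar n m - mainTerm n m)
            + (T - (mainTerm n ((m + 1 : ℕ) : ℝ) - mainTerm n m))| := by ring_nf
      _ ≤ _ := abs_add_le _ _
      _ ≤ _ := add_le_add ih hstep
      _ = _ := by rw [hc]; ring

lemma abs_Abar_sub_mainTerm_le {n : ℕ} (hn : 2 ≤ n) {x : ℝ} (hx : Real.sqrt n ≤ x)
    (hxn : x ≤ n) :
    |Abar n x - mainTerm n x| ≤ 22 * (n * Real.sqrt n * Real.log n) := by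
  have hn' : (0 : ℝ) < n := by positivity
  have hl := half_le_log hn
  have hs1 : 1 ≤ Real.sqrt n := Real.one_le_sqrt.2 (by exact_mod_cast (by omega))
  -- `Abar` and `mainTerm` are each at most `4 n y log n`, and `y ≤ 2√n`, hence `8 + 8 = 16`.
  have small : ∀ y : ℝ, 1 ≤ y → y ≤ 2 * Real.sqrt n → y ≤ n →
      |Abar n y - mainTerm n y| ≤ 16 * (n * Real.sqrt n * Real.log n) := by
    intro y hy1 hy2 hyn
    have hA := Abar_le (by linarith) hyn
    have hF := abs_mainTerm_le hn hy1 hyn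
    have hA0 := Abar_nonneg n y
    have : n * y * Real.log n ≤ n * (2 * Real.sqrt n) * Real.log n := by gcongr
    rw [abs_le] at hF ⊢
    constructor <;> linarith [hF.1, hF.2]
  set s := Real.sqrt n with hs
  have hss : s * s = n := Real.mul_self_sqrt hn'.le
  have hP : 0 ≤ n * s * Real.log n := by positivity
  set M := ⌈s⌉₊ with hMdef
  have hsM : s ≤ M := Nat.le_ceil s
  have hM2 : (M : ℝ) ≤ 2 * s := by linarith [Nat.ceil_lt_add_one (show 0 ≤ s by linarith)]
  set X := ⌊x⌋₊ with hXdef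
  have hXx : (X : ℝ) ≤ x := Nat.floor_le (by linarith)
  have hxX : x < X + 1 := Nat.lt_floor_add_one x
  rcases lt_or_ge X M with hlt | hge
  -- No integer lies in `[√n, x]`, so `x < ⌈√n⌉ ≤ 2√n`.
  · have : (X : ℝ) + 1 ≤ M := by exact_mod_cast hlt
    have := small x (by linarith) (by linarith) hxn
    linarith
  · have hMX : (M : ℝ) ≤ X := by exact_mod_cast hge
    have h0 := small M (by linarith) hM2 (by linarith)
    have h1 := abs_Abar_sub_mainTerm_le_of_le hn hsM hge (Nat.floor_le_of_le hxn)
    have h2 := abs_mainTerm_sub_le (n := n) (show (1 : ℝ) ≤ X by linarith) hXx hxn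
    have hA : Abar n x = Abar n (X : ℝ) := by rw [Abar, Abar, Nat.floor_natCast]
    have e1 : 4 * s * Real.log n * ((X : ℝ) - M) ≤ 4 * (n * s * Real.log n) := by
      calc _ ≤ 4 * s * Real.log n * n := by gcongr; linarith
        _ = _ := by ring
    have e2 : (n : ℝ) ^ 2 * Real.log n * (1 / (M : ℝ) - 1 / (X : ℝ)) ≤ n * s * Real.log n := by
      calc _ ≤ (n : ℝ) ^ 2 * Real.log n * (1 / s) := by
            gcongr
            have : 1 / (M : ℝ) ≤ 1 / s := by gcongr
            have : 0 ≤ 1 / (X : ℝ) := by positivity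
            linarith
        _ = n * (s * s) * Real.log n * (1 / s) := by rw [hss]; ring
        _ = _ := by field_simp
    have e3 : n * Real.log n * (x - X) ≤ n * s * Real.log n := by
      calc _ ≤ n * Real.log n * s := by gcongr; linarith
        _ = _ := by ring
    -- The total is `22 = 16 + 4 + 1 + 1`: start at `M`, unit steps, telescoped remainder, and
    -- passage from `⌊x⌋` to `x`.
    rw [hA]
    calc |Abar n (X : ℝ) - mainTerm n x|
        = |(Abar n (X : ℝ) - mainTerm n X) - (mainTerm n x - mainTerm n X)| := by ring_nf
      _ ≤ _ := abs_sub _ _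
      _ ≤ _ := by linarith

lemma rpow_three_halves (n : ℕ) (hn : 0 < n) : (n : ℝ) ^ (3 / 2 : ℝ) = n * Real.sqrt n := by
  rw [show (3 / 2 : ℝ) = 1 + 1 / 2 by norm_num, Real.rpow_add (by exact_mod_cast hn),
    Real.rpow_one, ← Real.sqrt_eq_rpow]

end RadixSums

theorem theorem1p6 :
    (∃ C : ℝ, ∀ n : ℕ, 2 ≤ n → ∀ α : ℝ, 1 / Real.sqrt n ≤ α → α ≤ 1 →
      |RadixSums.Abar n (α * n)
          - (RadixSums.fA α * (n : ℝ) ^ 2 * Real.log n + RadixSums.gA α * (n : ℝ) ^ 2)|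
        ≤ C * ((n : ℝ) ^ (3 / 2 : ℝ) * Real.log n)) ∧
    (∃ C : ℝ, ∀ n : ℕ, 2 ≤ n → ∀ α : ℝ, 1 / (n : ℝ) ≤ α → α ≤ 1 / Real.sqrt n →
      |RadixSums.Abar n (α * n)| ≤ C * ((n : ℝ) ^ (3 / 2 : ℝ) * Real.log n)) := by
  refine ⟨⟨22, fun n hn α h1 h2 => ?_⟩, ⟨4, fun n hn α h1 h2 => ?_⟩⟩
  · have hn' : (0 : ℝ) < n := by positivity
    have hx : Real.sqrt n ≤ α * n := by
      calc Real.sqrt n = 1 / Real.sqrt n * n := by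
            rw [one_div_mul_eq_div, Real.div_sqrt]
        _ ≤ α * n := by gcongr
    have h := RadixSums.abs_Abar_sub_mainTerm_le hn hx (mul_le_of_le_one_left hn'.le h2)
    rwa [RadixSums.mainTerm, mul_div_cancel_right₀ _ hn'.ne',
      ← RadixSums.rpow_three_halves n (by omega)] at h
  · have hn' : (0 : ℝ) < n := by positivity
    have hn1 : (1 : ℝ) ≤ n := by exact_mod_cast (by omega)
    have hα : 0 ≤ α := le_trans (by positivity) h1
    have hx : α * n ≤ Real.sqrt n := by
      calc α * n ≤ 1 / Real.sqrt n * n := by gcongr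
        _ = Real.sqrt n := by rw [one_div_mul_eq_div, Real.div_sqrt]
    have hsn : Real.sqrt n ≤ n := (Real.sqrt_le_left hn'.le).2 (by nlinarith)
    rw [abs_of_nonneg (RadixSums.Abar_nonneg _ _), RadixSums.rpow_three_halves n (by omega)]
    calc RadixSums.Abar n (α * n) ≤ 4 * n * (α * n) * Real.log n :=
          RadixSums.Abar_le (by positivity) (hx.trans hsn)
      _ ≤ 4 * n * Real.sqrt n * Real.log n := by
          gcongr
      _ = 4 * (n * Real.sqrt n * Real.log n) := by ring
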